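/- Let $\mathcal X$ be a finite set and let $\mathcal X^\infty$ be the set of one-way infinite sequences over $\mathcal X$, with the $\sigma$-field $\mathcal F$ generated by the cylinder sets $[x_{1..n}]$ (the set of all infinite sequences that start with $x_1,\dots,x_n$). For probability measures $\mu,\rho$ on $(\mathcal X^\infty,\mathcal F)$ put $$v(\mu,\rho,x_{1..n}) := \sup_{A\in\mathcal F}\bigl|\rho(A\mid x_{1..n})-\mu(A\mid x_{1..n})\bigr|,$$ where $\rho(A\mid x_{1..n})=\rho(A\cap[x_{1..n}])/\rho([x_{1..n}])$, read as $0$ if $\rho([x_{1..n}])=0$, and likewise for $\mu$. Say that $\rho$ predicts $\mu$ in total variation if $v(\mu,\rho,x_{1..n})\to 0$ as $n\to\infty$ for $\mu$-almost every sequence $x_1,x_2,\dots$. Theorem. Let $\mathcal C$ be a non-empty set of probability measures on $(\mathcal X^\infty,\mathcal F)$. If there is a probability measure $\rho$ on $(\mathcal X^\infty,\mathcal F)$ that predicts every $\mu\in\mathcal C$ in total variation, then there is a sequence $\mu_k\in\mathcal C$, $k\in\mathbb N$ (not necessarily of distinct measures), such that for all positive real weights $w_k$, $k\in\mathbb N$,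 with $\sum_{k\in\mathbb N} w_k=1$, the measure $\nu:=\sum_{k\in\mathbb N} w_k\mu_k$ predicts every $\mu\in\mathcal C$ in total variation. -/

import Mathlib

open MeasureTheory ProbabilityTheory Filter
open scoped Topology

/-- The total variation distance between the `ρ`- and the `μ`-conditional probabilities given the
first `n` symbols of `x`: the supremum over all measurable `A` of
`|ρ(A | x_1, …, x_n) - μ(A | x_1, …, x_n)|`. The set `PiNat.cylinder x n` consists of all the
sequences that agree with `x` in the first `n` places. Conditioning a measure on an event of
measure zero gives the zero measure, so this distance equals `1` if `x_1, …, x_n` has positive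
`μ`-probability and `ρ`-probability zero. -/
noncomputable def tvDist {X : Type*} [MeasurableSpace X] (μ ρ : Measure (ℕ → X))
    (x : ℕ → X) (n : ℕ) : ℝ :=
  ⨆ A : {A : Set (ℕ → X) // MeasurableSet A},
    |(ρ[|PiNat.cylinder x n]).real A.1 - (μ[|PiNat.cylinder x n]).real A.1|

/-- `ρ` predicts `μ` in total variation: the total variation distance between the conditional
probabilities given the first `n` symbols tends to `0` for `μ`-almost every sequence. -/
def PredictsInTV {X : Type*} [MeasurableSpace X] (ρ μ : Measure (ℕ → X)) : Prop :=
  ∀ᵐ x ∂μ, Tendsto (fun n => tvDist μ ρ x n) atTop (𝓝 0)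

/-!
For finite measures on sequences over a countable alphabet, `ρ` predicts `μ` in total variation if
and only if `μ ≪ ρ`. In one direction, if `ρ A = 0` then the total variation distance is at least
`μ (A | x_1, …, x_n)`, which by Lévy's zero-one law tends to `1` at `μ`-almost every point of `A`.
The other direction is the theorem of Blackwell and Dubins: multiplied by
`μ [x_{1..n}] / ρ [x_{1..n}]`, which tends to the density `dμ/dρ` at `x`, the distance is at most
twice the conditional mean oscillation of the density around its value at `x`, and almost every
sequence is a Lebesgue point of the density along cylinders.

A family dominated by `ρ` has a countable subfamily `(μ_k)` dominating all of it (Halmos–Savage):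
choose it so that the supports of the densities `dμ_k/dρ` cover as much `ρ`-mass as possible.
Every finite measure that dominates all `μ_k` then predicts the whole family.
-/

section HalmosSavage

open Measure

variable {Ω ι : Type*} [MeasurableSpace Ω]

theorem exists_countable_forall_ae_le_iUnion (ρ : Measure Ω) [SFinite ρ] {S : ι → Set Ω}
    (hS : ∀ i, NullMeasurableSet (S i) ρ) :
    ∃ t : Set ι, t.Countable ∧ ∀ i, S i ≤ᵐ[ρ] ⋃ j ∈ t, S j := by
  let V : Set ENNReal := Set.range fun t : {t : Set ι // t.Countable} =>
    ρ.toFinite (⋃ j ∈ t.1, S j)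
  have hV : V.Nonempty := ⟨_, ⟨∅, Set.countable_empty⟩, rfl⟩
  obtain ⟨u, -, hu, huV⟩ := exists_seq_tendsto_sSup hV (OrderTop.bddAbove V)
  choose T hT using huV
  let t : Set ι := ⋃ k, (T k).1
  have ht : t.Countable := Set.countable_iUnion fun k => (T k).2
  have hmax : sSup V ≤ ρ.toFinite (⋃ j ∈ t, S j) := le_of_tendsto' hu fun k =>
    (hT k).symm.le.trans
      (measure_mono (Set.biUnion_subset_biUnion_left (Set.subset_iUnion (fun k => (T k).1) k)))
  refine ⟨t, ht, fun i => ?_⟩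
  have hinsert : ρ.toFinite (⋃ j ∈ insert i t, S j) ≤ ρ.toFinite (⋃ j ∈ t, S j) :=
    (le_sSup (Set.mem_range_self (⟨insert i t, ht.insert i⟩ : {t : Set ι // t.Countable}))).trans
      hmax
  have hmeas : NullMeasurableSet (⋃ j ∈ t, S j) ρ.toFinite :=
    (NullMeasurableSet.biUnion ht fun j _ => hS j).mono_ac (toFinite_absolutelyContinuous ρ)
  have heq := ae_eq_of_subset_of_measure_ge
    (Set.biUnion_subset_biUnion_left (Set.subset_insert i t)) hinsert hmeas (measure_ne_top _ _)
  rw [ae_toFinite] at heq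
  exact (Set.subset_biUnion_of_mem (Set.mem_insert i t)).eventuallyLE.trans heq.symm.le

theorem absolutelyContinuous_restrict_support_rnDeriv {μ ρ : Measure Ω}
    [μ.HaveLebesgueDecomposition ρ] (h : μ ≪ ρ) :
    μ ≪ ρ.restrict (Function.support (μ.rnDeriv ρ)) := by
  have hsupp : MeasurableSet (Function.support (μ.rnDeriv ρ)) :=
    measurableSet_support (measurable_rnDeriv μ ρ)
  calc μ = ρ.withDensity ((Function.support (μ.rnDeriv ρ)).indicator (μ.rnDeriv ρ)) := by
        rw [Set.indicator_support, withDensity_rnDeriv_eq μ ρ h]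
    _ = (ρ.restrict (Function.support (μ.rnDeriv ρ))).withDensity (μ.rnDeriv ρ) :=
        withDensity_indicator hsupp _
    _ ≪ ρ.restrict (Function.support (μ.rnDeriv ρ)) := withDensity_absolutelyContinuous _ _

theorem restrict_support_rnDeriv_absolutelyContinuous (μ ρ : Measure Ω) :
    ρ.restrict (Function.support (μ.rnDeriv ρ)) ≪ μ := by
  have hsupp : MeasurableSet (Function.support (μ.rnDeriv ρ)) :=
    measurableSet_support (measurable_rnDeriv μ ρ)
  have hle : (ρ.restrict (Function.support (μ.rnDeriv ρ))).withDensity (μ.rnDeriv ρ) ≤ μ := by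
    rw [← restrict_withDensity hsupp]
    exact restrict_le_self.trans (withDensity_rnDeriv_le μ ρ)
  exact (withDensity_absolutelyContinuous' (measurable_rnDeriv μ ρ).aemeasurable
    (ae_restrict_mem hsupp)).trans hle.absolutelyContinuous

theorem exists_countable_forall_absolutelyContinuous_sum {ρ : Measure Ω} [SFinite ρ]
    {μ : ι → Measure Ω} [∀ i, SFinite (μ i)] (hμ : ∀ i, μ i ≪ ρ) :
    ∃ t : Set ι, t.Countable ∧ ∀ i, μ i ≪ sum fun j : t => μ j := by
  let S : ι → Set Ω := fun i => Function.support ((μ i).rnDeriv ρ.toFinite)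
  obtain ⟨t, ht, hS⟩ := exists_countable_forall_ae_le_iUnion ρ.toFinite (S := S) fun i =>
    (measurableSet_support (measurable_rnDeriv (μ i) ρ.toFinite)).nullMeasurableSet
  refine ⟨t, ht, fun i => ?_⟩
  have hi : μ i ≪ ρ.toFinite.restrict (S i) :=
    absolutelyContinuous_restrict_support_rnDeriv ((hμ i).trans (absolutelyContinuous_toFinite ρ))
  have hcover : ρ.toFinite.restrict (S i) ≤ sum fun j : t => ρ.toFinite.restrict (S j) :=
    (restrict_mono_ae (hS i)).trans (restrict_biUnion_le ht)
  exact (hi.trans hcover.absolutelyContinuous).trans (absolutelyContinuous_sum_left fun j =>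
    absolutelyContinuous_sum_right j (restrict_support_rnDeriv_absolutelyContinuous (μ j) _))

end HalmosSavage

section Cond

variable {Ω F : Type*} [MeasurableSpace Ω] [NormedAddCommGroup F]

theorem integrable_cond {μ : Measure Ω} {f : Ω → F} (hf : Integrable f μ) (s : Set Ω) :
    Integrable f μ[|s] := by
  rcases eq_or_ne (μ s) 0 with hs | hs
  · simp [cond_eq_zero_of_meas_eq_zero hs]
  · exact hf.restrict.smul_measure (ENNReal.inv_ne_top.2 hs)

theorem integral_norm_sub_le_add {P : Measure Ω} [IsZeroOrProbabilityMeasure P] {f : Ω → F}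
    (hf : Integrable f P) (b c : F) : ∫ y, ‖f y - c‖ ∂P ≤ (∫ y, ‖f y - b‖ ∂P) + ‖b - c‖ := by
  have hfb : Integrable (fun y => ‖f y - b‖) P := (hf.sub (integrable_const b)).norm
  calc ∫ y, ‖f y - c‖ ∂P ≤ ∫ y, (‖f y - b‖ + ‖b - c‖) ∂P :=
        integral_mono (hf.sub (integrable_const c)).norm (hfb.add (integrable_const _))
          fun y => norm_sub_le_norm_sub_add_norm_sub _ _ _
    _ = (∫ y, ‖f y - b‖ ∂P) + P.real Set.univ * ‖b - c‖ := by
        rw [integral_add hfb (integrable_const _), integral_const, smul_eq_mul]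
    _ ≤ (∫ y, ‖f y - b‖ ∂P) + ‖b - c‖ :=
        add_le_add_right (mul_le_of_le_one_left (norm_nonneg _) measureReal_le_one) _

theorem integral_norm_sub_integral_le [NormedSpace ℝ F] [CompleteSpace F] {P : Measure Ω}
    [IsZeroOrProbabilityMeasure P] {f : Ω → F} (hf : Integrable f P) (b : F) :
    ∫ y, ‖f y - ∫ z, f z ∂P‖ ∂P ≤ 2 * ∫ y, ‖f y - b‖ ∂P := by
  rcases eq_zero_or_isProbabilityMeasure P with rfl | _
  · simp
  have hmean : ‖b - ∫ z, f z ∂P‖ ≤ ∫ y, ‖f y - b‖ ∂P := by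
    have hsub : (∫ z, f z ∂P) - b = ∫ z, (f z - b) ∂P := by
      rw [integral_sub hf (integrable_const b), integral_const, probReal_univ, one_smul]
    rw [norm_sub_rev, hsub]
    exact norm_integral_le_integral_norm _
  linarith [integral_norm_sub_le_add hf b (∫ z, f z ∂P)]

theorem cond_real_apply {s : Set Ω} (hs : MeasurableSet s) (μ : Measure Ω) (A : Set Ω) :
    (μ[|s]).real A = (μ.real s)⁻¹ * μ.real (s ∩ A) := by
  rw [measureReal_def, cond_apply hs, ENNReal.toReal_mul, ENNReal.toReal_inv]
  rfl

variable {μ ν : Measure Ω} [IsFiniteMeasure μ] [SigmaFinite ν]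

theorem integral_rnDeriv_cond_mul_cond_real (hμν : μ ≪ ν) {s A : Set Ω} (hs : MeasurableSet s)
    (hA : MeasurableSet A) :
    (∫ y, (μ.rnDeriv ν y).toReal ∂ν[|s]) * (μ[|s]).real A =
      ∫ y in A, (μ.rnDeriv ν y).toReal ∂ν[|s] := by
  have hwhole : ∫ y, (μ.rnDeriv ν y).toReal ∂ν[|s] = (ν.real s)⁻¹ * μ.real s := by
    rw [ProbabilityTheory.cond, integral_smul_measure, Measure.setIntegral_toReal_rnDeriv hμν,
      ENNReal.toReal_inv, smul_eq_mul, ← measureReal_def]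
  have hpart : ∫ y in A, (μ.rnDeriv ν y).toReal ∂ν[|s] = (ν.real s)⁻¹ * μ.real (s ∩ A) := by
    rw [ProbabilityTheory.cond, Measure.restrict_smul, Measure.restrict_restrict hA,
      integral_smul_measure, Measure.setIntegral_toReal_rnDeriv hμν, ENNReal.toReal_inv,
      smul_eq_mul, Set.inter_comm, ← measureReal_def]
  rw [hwhole, hpart, cond_real_apply hs]
  rcases eq_or_ne (μ.real s) 0 with h | h
  · simp [h, measureReal_mono_null Set.inter_subset_left h]
  · rw [mul_assoc, mul_inv_cancel_left₀ h]

theorem integral_rnDeriv_cond_mul_abs_sub_le (hμν : μ ≪ ν) {s A : Set Ω} (hs : MeasurableSet s)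
    (hA : MeasurableSet A) (b : ℝ) :
    (∫ y, (μ.rnDeriv ν y).toReal ∂ν[|s]) * |(ν[|s]).real A - (μ[|s]).real A| ≤
      2 * ∫ y, ‖(μ.rnDeriv ν y).toReal - b‖ ∂ν[|s] := by
  set f : Ω → ℝ := fun y => (μ.rnDeriv ν y).toReal
  set a : ℝ := ∫ y, f y ∂ν[|s]
  have ha : 0 ≤ a := integral_nonneg fun y => ENNReal.toReal_nonneg
  have hf : Integrable f ν[|s] := integrable_cond Measure.integrable_toReal_rnDeriv s
  have hdiff : a * ((ν[|s]).real A - (μ[|s]).real A) = ∫ y in A, (a - f y) ∂ν[|s] := by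
    rw [mul_sub, integral_rnDeriv_cond_mul_cond_real hμν hs hA,
      integral_sub (integrable_const a) hf.integrableOn, setIntegral_const, smul_eq_mul, mul_comm a]
  calc a * |(ν[|s]).real A - (μ[|s]).real A| = ‖∫ y in A, (a - f y) ∂ν[|s]‖ := by
        rw [← hdiff, Real.norm_eq_abs, abs_mul, abs_of_nonneg ha]
    _ ≤ ∫ y in A, ‖a - f y‖ ∂ν[|s] := norm_integral_le_integral_norm _
    _ ≤ ∫ y, ‖a - f y‖ ∂ν[|s] :=
        setIntegral_le_integral ((integrable_const a).sub hf).norm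
          (ae_of_all _ fun _ => norm_nonneg _)
    _ = ∫ y, ‖f y - a‖ ∂ν[|s] := by simp_rw [norm_sub_rev a]
    _ ≤ 2 * ∫ y, ‖f y - b‖ ∂ν[|s] := integral_norm_sub_integral_le hf b

end Cond

section Cylinder

open Preorder Filtration

variable {E : ℕ → Type*}

theorem cylinder_succ_eq_preimage_restrictLe (x : ∀ n, E n) (n : ℕ) :
    PiNat.cylinder x (n + 1) = restrictLe n ⁻¹' {restrictLe n x} := by
  ext y
  simp [PiNat.mem_cylinder_iff, funext_iff]

theorem ae_measure_preimage_singleton_ne_zero {Ω α : Type*} [MeasurableSpace Ω] [Countable α]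
    (ν : Measure Ω) (f : Ω → α) : ∀ᵐ x ∂ν, ν (f ⁻¹' {f x}) ≠ 0 := by
  have hnull : ν (⋃ a ∈ {a | ν (f ⁻¹' {a}) = 0}, f ⁻¹' {a}) = 0 :=
    (measure_biUnion_null_iff (Set.to_countable _)).2 fun _ ha => ha
  refine measure_mono_null (fun x hx => ?_) hnull
  exact Set.mem_biUnion (x := f x) (not_not.1 hx) rfl

variable [∀ n, MeasurableSpace (E n)]

theorem iSup_piLE {ι : Type*} [Preorder ι] {F : ι → Type*} [∀ i, MeasurableSpace (F i)] :
    ⨆ i, (piLE (X := F) i : MeasurableSpace (∀ i, F i)) = MeasurableSpace.pi := by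
  refine le_antisymm (iSup_le piLE.le) (iSup_le fun i => ?_)
  have heval : Measurable[piLE (X := F) i] fun x : ∀ i, F i => x i :=
    (measurable_pi_apply (⟨i, le_rfl⟩ : Set.Iic i)).comp (comap_measurable (restrictLe i))
  exact heval.comap_le.trans (le_iSup (fun i => (piLE (X := F) i : MeasurableSpace _)) i)

variable [∀ n, MeasurableSingletonClass (E n)]

theorem measurableSet_piLE_cylinder_succ (x : ∀ n, E n) (n : ℕ) :
    MeasurableSet[piLE (X := E) n] (PiNat.cylinder x (n + 1)) :=
  ⟨{restrictLe n x}, measurableSet_singleton _, (cylinder_succ_eq_preimage_restrictLe x n).symm⟩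

theorem measurableSet_cylinder (x : ∀ n, E n) : ∀ n, MeasurableSet (PiNat.cylinder x n)
  | 0 => PiNat.cylinder_zero x ▸ .univ
  | n + 1 => piLE.le n _ (measurableSet_piLE_cylinder_succ x n)

theorem condExp_piLE_eq_integral_cond_cylinder {ν : Measure (∀ n, E n)} [IsFiniteMeasure ν]
    {g : (∀ n, E n) → ℝ} (hg : Integrable g ν) {x : ∀ n, E n} {n : ℕ}
    (hx : ν (PiNat.cylinder x (n + 1)) ≠ 0) :
    (ν[g | piLE (X := E) n]) x = ∫ y, g y ∂ν[|PiNat.cylinder x (n + 1)] := by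
  have hconst : ∀ y ∈ PiNat.cylinder x (n + 1),
      (ν[g | piLE (X := E) n]) y = (ν[g | piLE (X := E) n]) x := fun y hy =>
    stronglyMeasurable_condExp.dependsOn_of_piLE fun i hi => hy i (Nat.lt_succ_of_le hi)
  have hint : ν.real (PiNat.cylinder x (n + 1)) * (ν[g | piLE (X := E) n]) x =
      ∫ y in PiNat.cylinder x (n + 1), g y ∂ν := by
    rw [← setIntegral_condExp (piLE.le n) hg (measurableSet_piLE_cylinder_succ x n),
      setIntegral_congr_fun (measurableSet_cylinder x (n + 1)) hconst, setIntegral_const,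
      smul_eq_mul]
  have hpos : ν.real (PiNat.cylinder x (n + 1)) ≠ 0 := (measureReal_ne_zero_iff).2 hx
  rw [ProbabilityTheory.cond, integral_smul_measure, ← hint, ENNReal.toReal_inv, smul_eq_mul,
    ← measureReal_def, inv_mul_cancel_left₀ hpos]

variable [∀ n, Countable (E n)]

theorem ae_tendsto_integral_cond_cylinder {ν : Measure (∀ n, E n)} [IsFiniteMeasure ν]
    {g : (∀ n, E n) → ℝ} (hg : Integrable g ν) :
    ∀ᵐ x ∂ν, Tendsto (fun n => ∫ y, g y ∂ν[|PiNat.cylinder x n]) atTop (𝓝 (g x)) := by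
  have hlevy := tendsto_ae_condExp (μ := ν) (ℱ := piLE (X := E)) g
  rw [iSup_piLE] at hlevy
  have hpos : ∀ᵐ x ∂ν, ∀ n, ν (PiNat.cylinder x (n + 1)) ≠ 0 := ae_all_iff.2 fun n => by
    simpa only [cylinder_succ_eq_preimage_restrictLe] using
      ae_measure_preimage_singleton_ne_zero ν (restrictLe n)
  filter_upwards [hlevy, condExp_of_aestronglyMeasurable' le_rfl hg.1 hg, hpos] with x hx hgx hposx
  rw [hgx] at hx
  exact (tendsto_add_atTop_iff_nat 1).1
    (hx.congr fun n => condExp_piLE_eq_integral_cond_cylinder hg (hposx n))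

theorem ae_tendsto_cond_cylinder_real (ν : Measure (∀ n, E n)) [IsFiniteMeasure ν]
    {A : Set (∀ n, E n)} (hA : MeasurableSet A) :
    ∀ᵐ x ∂ν, Tendsto (fun n => (ν[|PiNat.cylinder x n]).real A) atTop (𝓝 (A.indicator 1 x)) := by
  simpa only [← Pi.one_def, integral_indicator_one hA] using
    ae_tendsto_integral_cond_cylinder ((integrable_const (μ := ν) (1 : ℝ)).indicator hA)

theorem ae_tendsto_integral_cond_cylinder_norm_sub {ν : Measure (∀ n, E n)} [IsFiniteMeasure ν]
    {f : (∀ n, E n) → ℝ} (hf : Integrable f ν) :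
    ∀ᵐ x ∂ν, Tendsto (fun n => ∫ y, ‖f y - f x‖ ∂ν[|PiNat.cylinder x n]) atTop (𝓝 0) := by
  -- The exceptional null set in Lévy's theorem depends on the constant subtracted from `f`, so the
  -- value `f x` is approximated by rationals.
  have hrat : ∀ᵐ x ∂ν, ∀ q : ℚ,
      Tendsto (fun n => ∫ y, ‖f y - q‖ ∂ν[|PiNat.cylinder x n]) atTop (𝓝 ‖f x - q‖) :=
    ae_all_iff.2 fun q => ae_tendsto_integral_cond_cylinder (hf.sub (integrable_const (q : ℝ))).norm
  filter_upwards [hrat] with x hx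
  refine tendsto_order.2 ⟨fun a ha => .of_forall fun n =>
    ha.trans_le (integral_nonneg fun y => norm_nonneg _), fun ε hε => ?_⟩
  obtain ⟨q, hq⟩ : ∃ q : ℚ, ‖f x - q‖ < ε / 2 := exists_rat_near (f x) (half_pos hε)
  have hlim : Tendsto (fun n => (∫ y, ‖f y - q‖ ∂ν[|PiNat.cylinder x n]) + ‖f x - q‖) atTop
      (𝓝 (‖f x - q‖ + ‖f x - q‖)) := (hx q).add_const _
  filter_upwards [hlim.eventually_lt_const (by linarith : ‖f x - q‖ + ‖f x - q‖ < ε)] with n hn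
  refine lt_of_le_of_lt ?_ hn
  rw [norm_sub_rev (f x)]
  exact integral_norm_sub_le_add (integrable_cond hf _) q (f x)

end Cylinder

section PredictsInTV

variable {X : Type*} [MeasurableSpace X]

theorem tvDist_nonneg (μ ρ : Measure (ℕ → X)) (x : ℕ → X) (n : ℕ) : 0 ≤ tvDist μ ρ x n :=
  Real.iSup_nonneg fun _ => abs_nonneg _

theorem abs_cond_real_sub_le_tvDist (μ ρ : Measure (ℕ → X)) (x : ℕ → X) (n : ℕ)
    {A : Set (ℕ → X)} (hA : MeasurableSet A) :
    |(ρ[|PiNat.cylinder x n]).real A - (μ[|PiNat.cylinder x n]).real A| ≤ tvDist μ ρ x n := by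
  refine le_ciSup (f := fun A : {A : Set (ℕ → X) // MeasurableSet A} =>
    |(ρ[|PiNat.cylinder x n]).real A.1 - (μ[|PiNat.cylinder x n]).real A.1|) ⟨1, ?_⟩ ⟨A, hA⟩
  rintro _ ⟨A, rfl⟩
  exact abs_sub_le_of_nonneg_of_le measureReal_nonneg measureReal_le_one measureReal_nonneg
    measureReal_le_one

theorem integral_rnDeriv_cond_mul_tvDist_le [MeasurableSingletonClass X] {μ ν : Measure (ℕ → X)}
    [IsFiniteMeasure μ] [SigmaFinite ν] (hμν : μ ≪ ν) (x : ℕ → X) (n : ℕ) (b : ℝ) :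
    (∫ y, (μ.rnDeriv ν y).toReal ∂ν[|PiNat.cylinder x n]) * tvDist μ ν x n ≤
      2 * ∫ y, ‖(μ.rnDeriv ν y).toReal - b‖ ∂ν[|PiNat.cylinder x n] := by
  rw [tvDist, Real.mul_iSup_of_nonneg (integral_nonneg fun y => ENNReal.toReal_nonneg)]
  exact Real.iSup_le (fun A =>
      integral_rnDeriv_cond_mul_abs_sub_le hμν (measurableSet_cylinder x n) A.2 b)
    (mul_nonneg zero_le_two (integral_nonneg fun y => norm_nonneg _))

variable [Countable X] [MeasurableSingletonClass X]

theorem PredictsInTV.absolutelyContinuous {μ ρ : Measure (ℕ → X)} [IsFiniteMeasure μ]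
    (h : PredictsInTV ρ μ) : μ ≪ ρ := by
  refine Measure.AbsolutelyContinuous.mk fun A hA hρA => ?_
  rw [measure_eq_zero_iff_ae_notMem]
  filter_upwards [h, ae_tendsto_cond_cylinder_real μ hA] with x htv hlevy hxA
  have hle : ∀ n, (μ[|PiNat.cylinder x n]).real A ≤ tvDist μ ρ x n := fun n => by
    have hρ : (ρ[|PiNat.cylinder x n]).real A = 0 := by
      rw [measureReal_def, cond_absolutelyContinuous hρA, ENNReal.toReal_zero]
    simpa only [hρ, zero_sub, abs_neg, abs_of_nonneg measureReal_nonneg] using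
      abs_cond_real_sub_le_tvDist μ ρ x n hA
  have h10 : (1 : ℝ) ≤ 0 := by
    simpa only [Set.indicator_of_mem hxA, Pi.one_apply] using
      le_of_tendsto_of_tendsto' hlevy htv hle
  exact zero_lt_one.not_ge h10

theorem predictsInTV_of_absolutelyContinuous {μ ν : Measure (ℕ → X)} [IsFiniteMeasure μ]
    [IsFiniteMeasure ν] (hμν : μ ≪ ν) : PredictsInTV ν μ := by
  let f : (ℕ → X) → ℝ := fun y => (μ.rnDeriv ν y).toReal
  have hf : Integrable f ν := Measure.integrable_toReal_rnDeriv
  have hfpos : ∀ᵐ x ∂μ, 0 < f x := by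
    filter_upwards [Measure.rnDeriv_pos hμν, hμν.ae_le (Measure.rnDeriv_lt_top μ ν)] with x hx hx'
    exact ENNReal.toReal_pos hx.ne' hx'.ne
  filter_upwards [hfpos, hμν.ae_le (ae_tendsto_integral_cond_cylinder hf),
    hμν.ae_le (ae_tendsto_integral_cond_cylinder_norm_sub hf)] with x hpos hmean hosc
  let a : ℕ → ℝ := fun n => ∫ y, f y ∂ν[|PiNat.cylinder x n]
  have hprod : Tendsto (fun n => a n * tvDist μ ν x n) atTop (𝓝 0) :=
    squeeze_zero
      (fun n => mul_nonneg (integral_nonneg fun y => ENNReal.toReal_nonneg) (tvDist_nonneg _ _ _ _))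
      (fun n => integral_rnDeriv_cond_mul_tvDist_le hμν x n (f x))
      (by simpa only [mul_zero] using hosc.const_mul 2)
  have hquot : Tendsto (fun n => a n * tvDist μ ν x n / a n) atTop (𝓝 0) :=
    zero_div (f x) ▸ hprod.div hmean hpos.ne'
  refine hquot.congr' ?_
  filter_upwards [hmean.eventually_ne hpos.ne'] with n hn
  exact mul_div_cancel_left₀ _ hn

end PredictsInTV

section Weights

variable {Ω ι : Type*} [MeasurableSpace Ω]

theorem isFiniteMeasure_sum_ofReal_smul {μ : ι → Measure Ω} [∀ k, IsProbabilityMeasure (μ k)]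
    {w : ι → ℝ} (hw : Summable w) :
    IsFiniteMeasure (Measure.sum fun k => ENNReal.ofReal (w k) • μ k) := by
  refine ⟨?_⟩
  simp only [Measure.sum_apply _ .univ, Measure.smul_apply, measure_univ, smul_eq_mul, mul_one]
  exact hw.tsum_ofReal_lt_top

theorem absolutelyContinuous_sum_ofReal_smul (μ : ι → Measure Ω) {w : ι → ℝ} {k : ι}
    (hk : 0 < w k) : μ k ≪ Measure.sum fun k => ENNReal.ofReal (w k) • μ k :=
  Measure.absolutelyContinuous_sum_right k
    (Measure.absolutelyContinuous_smul (ENNReal.ofReal_pos.2 hk).ne')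

end Weights

theorem theorem1_general {X : Type*} [Countable X] [MeasurableSpace X] [MeasurableSingletonClass X]
    (C : Set (ProbabilityMeasure (ℕ → X))) (hC : C.Nonempty)
    (hρ : ∃ ρ : ProbabilityMeasure (ℕ → X),
      ∀ μ ∈ C, PredictsInTV (ρ : Measure (ℕ → X)) (μ : Measure (ℕ → X))) :
    ∃ m : ℕ → ProbabilityMeasure (ℕ → X), (∀ k, m k ∈ C) ∧
      ∀ ν : Measure (ℕ → X), IsFiniteMeasure ν → (∀ k, (m k : Measure (ℕ → X)) ≪ ν) →
        ∀ μ ∈ C, PredictsInTV ν (μ : Measure (ℕ → X)) := by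
  obtain ⟨ρ, hρ⟩ := hρ
  obtain ⟨μ₀, hμ₀⟩ := hC
  obtain ⟨t, ht, hdom⟩ := exists_countable_forall_absolutelyContinuous_sum
    (μ := fun μ : C => (μ.1 : Measure (ℕ → X))) fun μ => (hρ μ μ.2).absolutelyContinuous
  obtain ⟨m, hm⟩ := (ht.insert ⟨μ₀, hμ₀⟩).exists_eq_range (Set.insert_nonempty _ _)
  refine ⟨fun k => m k, fun k => (m k).2, fun ν _ hν μ hμ => ?_⟩
  have hsum : (Measure.sum fun j : t => (j.1.1 : Measure (ℕ → X))) ≪ ν := by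
    refine Measure.absolutelyContinuous_sum_left fun j => ?_
    obtain ⟨k, hk⟩ : j.1 ∈ Set.range m := hm ▸ Set.mem_insert_of_mem _ j.2
    exact hk ▸ hν k
  exact predictsInTV_of_absolutelyContinuous ((hdom ⟨μ, hμ⟩).trans hsum)

theorem theorem1 {X : Type*} [Finite X] [MeasurableSpace X] [DiscreteMeasurableSpace X]
    (C : Set (ProbabilityMeasure (ℕ → X))) (hC : C.Nonempty)
    (hρ : ∃ ρ : ProbabilityMeasure (ℕ → X),
      ∀ μ ∈ C, PredictsInTV (ρ : Measure (ℕ → X)) (μ : Measure (ℕ → X))) :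
    ∃ m : ℕ → ProbabilityMeasure (ℕ → X), (∀ k, m k ∈ C) ∧
      ∀ w : ℕ → ℝ, (∀ k, 0 < w k) → HasSum w 1 →
        ∀ μ ∈ C, PredictsInTV
          (Measure.sum fun k => ENNReal.ofReal (w k) • (m k : Measure (ℕ → X)))
          (μ : Measure (ℕ → X)) := by
  obtain ⟨m, hmC, hm⟩ := theorem1_general C hC hρ
  exact ⟨m, hmC, fun w hw hsum => hm _ (isFiniteMeasure_sum_ofReal_smul hsum.summable) fun k =>
    absolutelyContinuous_sum_ofReal_smul (fun k => (m k : Measure (ℕ → X))) (hw k)⟩
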